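/- Let $C$ be the Banach space of continuous functions $x:[0,1]\to\mathbb R$ with the maximum norm, let $L$ be the Banach space of Lebesgue integrable functions on $[0,1]$ with norm $\int_0^1|z(s)|\,ds$, and let $k>0$. Denote by $D_+$ the set of all continuous functions $x:[0,1]\to\mathbb R$ that are locally absolutely continuous on $(0,1]$ and for which there is $f\in L$ with $\dot x(t)=-\frac kt x(t)+f(t)$ for almost every $t\in(0,1]$ and $x(1)=\int_0^1 s^kf(s)\,ds$. A linear operator $C\to L$ is called positive if it maps nonnegative functions to almost everywhere nonnegative functions. For a bounded linear operator $T:C\to L$ consider the Cauchy problem $$\dot x(t)=-\frac kt x(t)+(Tx)(t)+f(t)\ \text{ for a.e. } t\in[0,1],\qquad x(0)=0,\tag{1}$$ and call (1) uniquely solvable in $D_+$ if for every $f\in L$ there is exactly one $x\in D_+$ satisfying (1). Theorem. Let $k>0$, $\mathcal T^+\ge0$ and $\mathcal T^-\ge0$. Problem (1) is uniquely solvable in $D_+$ for every operator $T=T^+-T^-$, where $T^+,T^-:C\to L$ are positive linear operators with operator norms $\|T^+\|_{C\to L}=\mathcal T^+$ and $\|T^-\|_{C\to L}=\mathcal T^-$,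 if and only if $$\mathcal T^+\le1\quad\text{and}\quad \mathcal T^-\le2\sqrt{1-\mathcal T^+}.$$ -/

import Mathlib

open MeasureTheory Set

noncomputable section

namespace SingularCauchy

/-- The Banach space `C` of continuous functions on `[0,1]` with the maximum norm. -/
abbrev SpaceC : Type := C(unitInterval, ℝ)

/-- The Banach space `L` of (classes of) Lebesgue integrable functions on `[0,1]`,
with the norm `∫₀¹ |z|`. -/
abbrev SpaceL : Type := Lp ℝ 1 ((volume : Measure ℝ).restrict (Icc (0 : ℝ) 1))

/-- A function on `[0,1]` regarded as a function of a real variable, extended by constants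
outside `[0,1]`. Only its values on `[0,1]` matter below. -/
def toReal (x : SpaceC) : ℝ → ℝ := IccExtend (zero_le_one' ℝ) x

/-- `x` is a solution on `(0,1]` of the model equation `x' = -(k/t) x + f`: it is locally absolutely
continuous on `(0,1]` and satisfies the equation almost everywhere. -/
def IsModelSolution (k : ℝ) (f : SpaceL) (x : ℝ → ℝ) : Prop :=
  (∀ ε ∈ Ioo (0 : ℝ) 1, AbsolutelyContinuousOnInterval x ε 1) ∧
    ∀ᵐ t ∂((volume : Measure ℝ).restrict (Icc (0 : ℝ) 1)),
      HasDerivAt x (-(k / t) * x t + f t) t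

/-- The solution space `D₊` (for `k > 0`): all solutions of the model equation, for some `f ∈ L`,
with `x(1) = ∫₀¹ s ^ k f(s) ds`, extended by continuity to `t = 0`. -/
def SpaceDPlus (k : ℝ) : Set SpaceC :=
  {x | ∃ f : SpaceL, IsModelSolution k f (toReal x) ∧
    toReal x 1 = ∫ s in Icc (0 : ℝ) 1, s ^ k * f s}

/-- `T : C → L` maps nonnegative functions to almost everywhere nonnegative functions. -/
def IsPositiveOperator (T : SpaceC →L[ℝ] SpaceL) : Prop :=
  ∀ x : SpaceC, 0 ≤ x → 0 ≤ T x

/-- `x` is a solution in `D₊` of the Cauchy problem `x' = -(k/t) x + T x + f`, `x(0) = 0`. -/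
def IsCauchySolution (k : ℝ) (T : SpaceC →L[ℝ] SpaceL) (f : SpaceL) (x : SpaceC) : Prop :=
  x ∈ SpaceDPlus k ∧
    (∀ᵐ t ∂((volume : Measure ℝ).restrict (Icc (0 : ℝ) 1)),
      HasDerivAt (toReal x) (-(k / t) * toReal x t + T x t + f t) t) ∧
    toReal x 0 = 0

/-- The Cauchy problem has exactly one solution in `D₊` for every `f ∈ L`. -/
def UniquelySolvable (k : ℝ) (T : SpaceC →L[ℝ] SpaceL) : Prop :=
  ∀ f : SpaceL, ∃! x : SpaceC, IsCauchySolution k T f x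

end SingularCauchy

end

/-! Multiplying the model equation by `t ^ k` shows that its solutions in `D₊` are exactly `x = G
f`, with `G f (t) = ∫₀ᵗ (s/t)^k f(s) ds`. The Cauchy problem thus becomes `x = G (T x + f)`. For a
positive operator `T` the map `G T` is compact on `C`, so by the Fredholm alternative unique
solvability follows once `x = G T x` has only the zero solution.

Sufficiency. Let `x ≠ 0` solve `x = G T x`, with maximum `M` at `t` and minimum `-N` at `u`;
replacing `x` by `-x` if necessary, `t < u` when both signs occur. Let `a₁, a₂` be the integrals of
`T⁺1`, and `b₁, b₂` those of `T⁻1`, over `[0,t]` and `[t,u]`. The kernel is below 1 and the solution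
decays freely, so `M < M a₁ + N b₁` and `N < N a₂ + M b₂`, both strictly. Multiplication gives
`(1-a₁)(1-a₂) < b₁ b₂`, while the left side is at least `1 - ‖T⁺‖` and the right side at most
`‖T⁻‖²/4` (`no_crossing_amplitudes`). For a solution of one sign, `M < M a₁` already contradicts
`‖T⁺‖ ≤ 1`.

Necessity. Operators built from point evaluations and concentrated forcing terms nearly attain these
inequalities. When the norm condition fails there is enough slack to create a nonzero homogeneous
solution (`exists_not_uniquelySolvable`). Strict inequality is needed for this, which is why the
boundary case is solvable. -/

noncomputable section

namespace SingularCauchy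

open Filter Topology

/-! ### The solution operator of the model equation -/

/-- The kernel of the solution operator of the model equation. -/
def weight (k t s : ℝ) : ℝ := if s ≤ t then (s / t) ^ k else 0

lemma weight_nonneg {k t s : ℝ} (hs : 0 ≤ s) : 0 ≤ weight k t s := by
  unfold weight
  split_ifs with h
  · exact Real.rpow_nonneg (div_nonneg hs (hs.trans h)) _
  · exact le_rfl

lemma weight_le_one {k t s : ℝ} (hk : 0 < k) (hs : 0 ≤ s) : weight k t s ≤ 1 := by
  unfold weight
  split_ifs with h
  · exact Real.rpow_le_one (div_nonneg hs (hs.trans h)) (div_le_one_of_le₀ h (hs.trans h)) hk.le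
  · exact zero_le_one

lemma norm_weight_le_one {k t s : ℝ} (hk : 0 < k) (hs : 0 ≤ s) : ‖weight k t s‖ ≤ 1 := by
  rw [Real.norm_of_nonneg (weight_nonneg hs)]
  exact weight_le_one hk hs

lemma measurable_weight (k t : ℝ) : Measurable (weight k t) :=
  Measurable.ite measurableSet_Iic (by fun_prop) measurable_const

/-- As a function of `t` the kernel jumps only at `t = s`. For fixed `t₀` this excludes a null set
of `s`, so dominated convergence applies. -/
lemma continuousAt_weight {k t₀ s : ℝ} (hs : 0 < s) (h : s ≠ t₀) :
    ContinuousAt (fun t ↦ weight k t s) t₀ := by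
  rcases lt_or_gt_of_ne h with h | h
  · have : (fun t ↦ weight k t s) =ᶠ[𝓝 t₀] fun t ↦ (s / t) ^ k := by
      filter_upwards [lt_mem_nhds h] with t ht
      simp [weight, ht.le]
    refine ContinuousAt.congr ?_ this.symm
    have h0 : t₀ ≠ 0 := (hs.trans h).ne'
    exact (continuousAt_const.div continuousAt_id h0).rpow_const
      (Or.inl (div_ne_zero hs.ne' h0))
  · have : (fun t ↦ weight k t s) =ᶠ[𝓝 t₀] fun _ ↦ 0 := by
      filter_upwards [gt_mem_nhds h] with t ht
      simp [weight, ht]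
    exact continuousAt_const.congr this.symm

/-- Lebesgue measure on `[0,1]`. -/
abbrev unitMeasure : Measure ℝ := (volume : Measure ℝ).restrict (Icc (0 : ℝ) 1)

lemma ae_unitMeasure_mem_Ioo : ∀ᵐ s ∂unitMeasure, s ∈ Ioo (0 : ℝ) 1 := by
  rw [unitMeasure, ← restrict_Ioo_eq_restrict_Icc]
  exact ae_restrict_mem measurableSet_Ioo

lemma ae_unitMeasure_ne (a : ℝ) : ∀ᵐ s ∂unitMeasure, s ≠ a :=
  ae_restrict_of_ae (by simp [ae_iff, measure_singleton])

lemma integrable_weight_mul {k : ℝ} (hk : 0 < k) (t : ℝ) {f : ℝ → ℝ}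
    (hf : Integrable f unitMeasure) : Integrable (fun s ↦ weight k t s * f s) unitMeasure :=
  hf.bdd_mul (measurable_weight k t).aestronglyMeasurable
    (ae_unitMeasure_mem_Ioo.mono fun _ hs ↦ norm_weight_le_one hk hs.1.le)

/-- The solution of `x' = -(k/t) x + f` that is bounded at `0`. -/
def green (k : ℝ) (f : ℝ → ℝ) (t : ℝ) : ℝ := ∫ s, weight k t s * f s ∂unitMeasure

lemma continuous_green {k : ℝ} (hk : 0 < k) {f : ℝ → ℝ} (hf : Integrable f unitMeasure) :
    Continuous (green k f) := by
  rw [continuous_iff_continuousAt]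
  intro t₀
  refine continuousAt_of_dominated (bound := fun s ↦ ‖f s‖)
    (Eventually.of_forall fun t ↦ (integrable_weight_mul hk t hf).aestronglyMeasurable)
    (Eventually.of_forall fun t ↦ ?_) hf.norm ?_
  · filter_upwards [ae_unitMeasure_mem_Ioo] with s hs
    rw [norm_mul]
    exact mul_le_of_le_one_left (norm_nonneg _) (norm_weight_le_one hk hs.1.le)
  · filter_upwards [ae_unitMeasure_mem_Ioo, ae_unitMeasure_ne t₀] with s hs hne
    exact (continuousAt_weight hs.1 hne).mul continuousAt_const

lemma norm_green_le {k : ℝ} (hk : 0 < k) {f : ℝ → ℝ} (hf : Integrable f unitMeasure) (t : ℝ) :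
    ‖green k f t‖ ≤ ∫ s, ‖f s‖ ∂unitMeasure := by
  refine norm_integral_le_of_norm_le hf.norm ?_
  filter_upwards [ae_unitMeasure_mem_Ioo] with s hs
  rw [norm_mul]
  exact mul_le_of_le_one_left (norm_nonneg _) (norm_weight_le_one hk hs.1.le)

lemma green_congr {k : ℝ} {f g : ℝ → ℝ} (h : f =ᵐ[unitMeasure] g) (t : ℝ) :
    green k f t = green k g t :=
  integral_congr_ae (h.mono fun s hs ↦ by simp only [hs])

lemma green_add {k : ℝ} (hk : 0 < k) {f g : ℝ → ℝ} (hf : Integrable f unitMeasure)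
    (hg : Integrable g unitMeasure) (t : ℝ) :
    green k (f + g) t = green k f t + green k g t := by
  simp only [green, Pi.add_apply, mul_add]
  exact integral_add (integrable_weight_mul hk t hf) (integrable_weight_mul hk t hg)

lemma green_smul (k c : ℝ) (f : ℝ → ℝ) (t : ℝ) : green k (c • f) t = c * green k f t := by
  simp only [green, Pi.smul_apply, smul_eq_mul, mul_left_comm _ c, integral_const_mul]

lemma green_zero (k : ℝ) (f : ℝ → ℝ) : green k f 0 = 0 := by
  refine integral_eq_zero_of_ae ?_
  filter_upwards [ae_unitMeasure_mem_Ioo] with s hs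
  simp [weight, hs.1]

lemma integrable_coe (f : SpaceL) : Integrable f unitMeasure := L1.integrable_coeFn f

/-- The solution operator of the model equation as a bounded operator from `L` to `C`. -/
def greenOp (k : ℝ) (hk : 0 < k) : SpaceL →L[ℝ] SpaceC :=
  LinearMap.mkContinuous
    { toFun := fun f ↦ ⟨fun t ↦ green k f t,
        (continuous_green hk (integrable_coe f)).comp continuous_subtype_val⟩
      map_add' := fun f g ↦ by
        ext t
        simp only [ContinuousMap.coe_mk, ContinuousMap.add_apply]
        rw [green_congr (Lp.coeFn_add f g), green_add hk (integrable_coe f) (integrable_coe g)]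
      map_smul' := fun c f ↦ by
        ext t
        simp only [ContinuousMap.coe_mk, ContinuousMap.smul_apply, RingHom.id_apply, smul_eq_mul]
        rw [green_congr (Lp.coeFn_smul c f), green_smul] }
    1 fun f ↦ by
      rw [ContinuousMap.norm_le _ (by positivity), one_mul, L1.norm_eq_integral_norm]
      exact fun t ↦ norm_green_le hk (integrable_coe f) t

lemma greenOp_apply {k : ℝ} (hk : 0 < k) (f : SpaceL) (t : unitInterval) :
    greenOp k hk f t = green k f t := rfl

lemma integrableOn_coe (f : SpaceL) : IntegrableOn f (Icc 0 1) volume := L1.integrable_coeFn f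

lemma integrableOn_rpow_mul {k : ℝ} (hk : 0 < k) {f : ℝ → ℝ} (hf : Integrable f unitMeasure) :
    IntegrableOn (fun s ↦ s ^ k * f s) (Icc 0 1) volume := by
  refine hf.bdd_mul (c := 1) (by fun_prop) (ae_unitMeasure_mem_Ioo.mono fun s hs ↦ ?_)
  rw [Real.norm_of_nonneg (Real.rpow_nonneg hs.1.le _)]
  exact Real.rpow_le_one hs.1.le hs.2.le hk.le

lemma intervalIntegrable_of_mem {f : ℝ → ℝ} (hf : IntegrableOn f (Icc 0 1) volume) {a b : ℝ}
    (ha : a ∈ Icc (0 : ℝ) 1) (hb : b ∈ Icc (0 : ℝ) 1) : IntervalIntegrable f volume a b :=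
  (hf.mono_set (uIcc_subset_Icc ha hb)).intervalIntegrable

lemma setIntegral_Icc_indicator {f : ℝ → ℝ} {a b : ℝ} (ha : 0 ≤ a) (hab : a ≤ b) (hb : b ≤ 1) :
    ∫ s in Icc 0 1, (Ioc a b).indicator f s = ∫ s in a..b, f s := by
  rw [setIntegral_indicator measurableSet_Ioc, intervalIntegral.integral_of_le hab,
    inter_eq_self_of_subset_right (Ioc_subset_Icc_self.trans (Icc_subset_Icc ha hb))]

/-- `t ^ k` is the integrating factor of the model equation; this form separates the variables `t`
and `s`. -/
lemma rpow_mul_green (k : ℝ) (f : ℝ → ℝ) {t : ℝ} (ht : t ∈ Ioc (0 : ℝ) 1) :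
    t ^ k * green k f t = ∫ s in (0 : ℝ)..t, s ^ k * f s := by
  rw [← setIntegral_Icc_indicator le_rfl ht.1.le ht.2, green, ← integral_const_mul]
  refine integral_congr_ae ?_
  filter_upwards [ae_unitMeasure_mem_Ioo] with s hs
  by_cases h : s ≤ t
  · rw [indicator_of_mem (show s ∈ Ioc 0 t from ⟨hs.1, h⟩), weight, if_pos h,
      Real.div_rpow hs.1.le ht.1.le]
    have := (Real.rpow_pos_of_pos ht.1 k).ne'
    field_simp
  · rw [indicator_of_notMem (fun h' ↦ h h'.2), weight, if_neg h]
    simp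

lemma green_eq (k : ℝ) (f : ℝ → ℝ) {t : ℝ} (ht : t ∈ Ioc (0 : ℝ) 1) :
    green k f t = t ^ (-k) * ∫ s in (0 : ℝ)..t, s ^ k * f s := by
  rw [← rpow_mul_green k f ht, ← mul_assoc, ← Real.rpow_add ht.1]
  simp

lemma toReal_apply (x : SpaceC) {t : ℝ} (ht : t ∈ Icc (0 : ℝ) 1) : toReal x t = x ⟨t, ht⟩ :=
  IccExtend_of_mem _ _ ht

lemma toReal_greenOp {k : ℝ} (hk : 0 < k) (f : SpaceL) {t : ℝ} (ht : t ∈ Icc (0 : ℝ) 1) :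
    toReal (greenOp k hk f) t = green k f t := toReal_apply _ ht

/-! ### Reduction of the Cauchy problem to a fixed-point equation -/

lemma absolutelyContinuousOnInterval_rpow (c : ℝ) {a b : ℝ} (ha : 0 < a) (hab : a ≤ b) :
    AbsolutelyContinuousOnInterval (fun t ↦ t ^ c) a b := by
  refine ContDiffOn.absolutelyContinuousOnInterval fun t ht ↦ ?_
  rw [uIcc_of_le hab] at ht
  exact (Real.contDiffAt_rpow_const_of_ne (ha.trans_le ht.1).ne').contDiffWithinAt

lemma AbsolutelyContinuousOnInterval.congr {f g : ℝ → ℝ} {a b : ℝ}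
    (hf : AbsolutelyContinuousOnInterval f a b) (h : EqOn f g (uIcc a b)) :
    AbsolutelyContinuousOnInterval g a b := by
  rw [absolutelyContinuousOnInterval_iff] at hf ⊢
  intro ε hε
  obtain ⟨δ, hδ, H⟩ := hf ε hε
  refine ⟨δ, hδ, fun E hE hE' ↦ ?_⟩
  convert H E hE hE' using 1
  refine Finset.sum_congr rfl fun i hi ↦ ?_
  rw [h (hE.1 i hi).1, h (hE.1 i hi).2]

lemma isModelSolution_greenOp {k : ℝ} (hk : 0 < k) (f : SpaceL) :
    IsModelSolution k f (toReal (greenOp k hk f)) := by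
  have hi := integrableOn_rpow_mul hk (integrable_coe f)
  have hi1 : IntervalIntegrable (fun s ↦ s ^ k * f s) volume 0 1 :=
    intervalIntegrable_of_mem hi (by simp) (by simp)
  constructor
  · intro ε hε
    have h1 := absolutelyContinuousOnInterval_rpow (-k) hε.1 hε.2.le
    have h2 : AbsolutelyContinuousOnInterval (fun t ↦ ∫ s in (0 : ℝ)..t, s ^ k * f s) ε 1 :=
      (hi1.absolutelyContinuousOnInterval_intervalIntegral (by simp)).mono
        (by rw [uIcc_of_le hε.2.le, uIcc_of_le zero_le_one]; exact Icc_subset_Icc_left hε.1.le)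
    refine AbsolutelyContinuousOnInterval.congr (h1.mul h2) fun t ht ↦ ?_
    rw [uIcc_of_le hε.2.le] at ht
    rw [toReal_greenOp hk f ⟨hε.1.le.trans ht.1, ht.2⟩, green_eq k f ⟨hε.1.trans_le ht.1, ht.2⟩]
    rfl
  · filter_upwards [ae_unitMeasure_mem_Ioo, ae_restrict_of_ae hi1.ae_hasDerivAt_integral]
      with t ht hd
    have h1 := hd (by rw [uIcc_of_le zero_le_one]; exact Ioo_subset_Icc_self ht) 0 (by simp)
    have h2 := (Real.hasDerivAt_rpow_const (p := -k) (Or.inl ht.1.ne')).mul h1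
    have h3 : toReal (greenOp k hk f) =ᶠ[𝓝 t]
        (fun t ↦ t ^ (-k)) * fun t ↦ ∫ s in (0 : ℝ)..t, s ^ k * f s := by
      filter_upwards [Ioo_mem_nhds ht.1 ht.2] with u hu
      rw [toReal_greenOp hk f (Ioo_subset_Icc_self hu), green_eq k f (Ioo_subset_Ioc_self hu)]
      rfl
    refine (h2.congr_of_eventuallyEq h3).congr_deriv ?_
    rw [toReal_greenOp hk f (Ioo_subset_Icc_self ht), green_eq k f (Ioo_subset_Ioc_self ht),
      Real.rpow_sub_one ht.1.ne', Real.rpow_neg ht.1.le]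
    have := (Real.rpow_pos_of_pos ht.1 k).ne'
    field_simp

lemma toReal_greenOp_one {k : ℝ} (hk : 0 < k) (f : SpaceL) :
    toReal (greenOp k hk f) 1 = ∫ s in Icc (0 : ℝ) 1, s ^ k * f s := by
  rw [toReal_greenOp hk f (by simp), green_eq k f (by simp), Real.one_rpow, one_mul,
    intervalIntegral.integral_of_le zero_le_one, integral_Icc_eq_integral_Ioc]

/-- `t ^ k * x` is absolutely continuous away from `0` with derivative `t ^ k * f`. The condition at
`1` removes the remaining multiple of `t ^ (-k)`. -/
lemma IsModelSolution.eq_green {k : ℝ} (hk : 0 < k) {f : SpaceL} {x : ℝ → ℝ}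
    (hx : IsModelSolution k f x) (h1 : x 1 = ∫ s in Icc (0 : ℝ) 1, s ^ k * f s)
    {t : ℝ} (ht : t ∈ Ioc (0 : ℝ) 1) : x t = green k f t := by
  have hi := integrableOn_rpow_mul hk (integrable_coe f)
  rw [integral_Icc_eq_integral_Ioc, ← intervalIntegral.integral_of_le zero_le_one] at h1
  rcases eq_or_lt_of_le ht.2 with rfl | ht1
  · rw [h1, green_eq k f ht]
    simp
  have hac := (absolutelyContinuousOnInterval_rpow k ht.1 ht.2).mul (hx.1 t ⟨ht.1, ht1⟩)
  have hderiv : ∫ s in t..1, deriv ((fun t ↦ t ^ k) * x) s = ∫ s in t..1, s ^ k * f s := by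
    refine intervalIntegral.integral_congr_ae ?_
    have := hx.2
    rw [ae_restrict_iff' measurableSet_Icc] at this
    filter_upwards [this] with s hs hst
    rw [uIoc_of_le ht.2] at hst
    have hs0 := ht.1.trans hst.1
    have h2 := (Real.hasDerivAt_rpow_const (p := k) (Or.inl hs0.ne')).mul (hs ⟨hs0.le, hst.2⟩)
    rw [h2.deriv, Real.rpow_sub_one hs0.ne']
    field_simp
    ring
  rw [hac.integral_deriv_eq_sub] at hderiv
  have hadd := intervalIntegral.integral_add_adjacent_intervals
    (intervalIntegrable_of_mem (a := 0) hi (by simp) (Ioc_subset_Icc_self ht))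
    (intervalIntegrable_of_mem (b := 1) hi (Ioc_subset_Icc_self ht) (by simp))
  rw [← rpow_mul_green k f ht] at hadd
  simp only [Pi.mul_apply, Real.one_rpow, one_mul, h1] at hderiv
  have hp := (Real.rpow_pos_of_pos ht.1 k).ne'
  refine mul_left_cancel₀ hp ?_
  linarith

lemma isCauchySolution_iff {k : ℝ} (hk : 0 < k) (T : SpaceC →L[ℝ] SpaceL) (f : SpaceL)
    (x : SpaceC) : IsCauchySolution k T f x ↔ x = greenOp k hk (T x + f) := by
  constructor
  · rintro ⟨⟨g, hg, hg1⟩, hd, h0⟩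
    -- The forcing term in the definition of `D₊` is determined by `x`, because derivatives are
    -- unique.
    have hgf : g = T x + f := by
      refine Lp.ext ?_
      filter_upwards [hg.2, hd, Lp.coeFn_add (T x) f] with t h1 h2 h3
      have := h1.unique h2
      rw [h3, Pi.add_apply]
      linarith
    rw [← hgf]
    ext t
    rw [greenOp_apply]
    rcases eq_or_lt_of_le t.2.1 with ht | ht
    · rw [← ht, green_zero, ← h0, toReal_apply x (by simp)]
      exact congrArg x (Subtype.ext ht.symm)
    · rw [← hg.eq_green hk hg1 ⟨ht, t.2.2⟩, toReal_apply x t.2]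
  · intro hx
    have hm := isModelSolution_greenOp hk (T x + f)
    have h1 := toReal_greenOp_one hk (T x + f)
    have h0 : toReal (greenOp k hk (T x + f)) 0 = 0 := by
      rw [toReal_greenOp hk _ (by simp), green_zero]
    rw [← hx] at hm h1 h0
    refine ⟨⟨T x + f, hm, h1⟩, ?_, h0⟩
    filter_upwards [hm.2, Lp.coeFn_add (T x) f] with t h1 h2
    rw [h2, Pi.add_apply, ← add_assoc] at h1
    exact h1

/-! ### Compactness and the Fredholm alternative -/

lemma IsPositiveOperator.mono {T : SpaceC →L[ℝ] SpaceL} (hT : IsPositiveOperator T) {x y : SpaceC}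
    (h : x ≤ y) : T x ≤ T y := by
  have := hT (y - x) (sub_nonneg.2 h)
  rwa [map_sub, sub_nonneg] at this

lemma IsPositiveOperator.ae_nonneg {T : SpaceC →L[ℝ] SpaceL} (hT : IsPositiveOperator T) :
    ∀ᵐ s ∂unitMeasure, 0 ≤ T 1 s :=
  (Lp.coeFn_nonneg _).2 (hT 1 fun _ ↦ zero_le_one)

lemma IsPositiveOperator.ae_le {T : SpaceC →L[ℝ] SpaceL} (hT : IsPositiveOperator T) {x : SpaceC}
    {M : ℝ} (h : ∀ t, x t ≤ M) : ∀ᵐ s ∂unitMeasure, T x s ≤ M * T 1 s := by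
  have h1 : T x ≤ T (M • 1) := hT.mono fun t ↦ by simpa using h t
  rw [map_smul, ← Lp.coeFn_le] at h1
  filter_upwards [h1, Lp.coeFn_smul M (T 1)] with s h2 h3
  rwa [h3] at h2

lemma IsPositiveOperator.le_ae {T : SpaceC →L[ℝ] SpaceL} (hT : IsPositiveOperator T) {x : SpaceC}
    {M : ℝ} (h : ∀ t, -M ≤ x t) : ∀ᵐ s ∂unitMeasure, -(M * T 1 s) ≤ T x s := by
  filter_upwards [hT.ae_le (x := -x) (M := M) (fun t ↦ by
    rw [ContinuousMap.neg_apply]; linarith [h t]), Lp.coeFn_neg (T x)] with s h1 h2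
  rw [map_neg, h2, Pi.neg_apply] at h1
  linarith

lemma abs_green_sub_le {k : ℝ} (hk : 0 < k) {f F : ℝ → ℝ} (hf : Integrable f unitMeasure)
    (hF : Integrable F unitMeasure) (h : ∀ᵐ s ∂unitMeasure, |f s| ≤ F s) (t u : ℝ) :
    |green k f t - green k f u| ≤ ∫ s, |weight k t s - weight k u s| * F s ∂unitMeasure := by
  rw [green, green, ← integral_sub (integrable_weight_mul hk t hf) (integrable_weight_mul hk u hf)]
  rw [← Real.norm_eq_abs]
  refine norm_integral_le_of_norm_le ?_ ?_
  · have := (integrable_weight_mul hk t hF).sub (integrable_weight_mul hk u hF)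
    refine this.norm.congr ?_
    filter_upwards [h] with s hs
    rw [Pi.sub_apply, ← sub_mul, norm_mul, Real.norm_eq_abs,
      Real.norm_of_nonneg ((abs_nonneg _).trans hs)]
  · filter_upwards [h] with s hs
    rw [← sub_mul, norm_mul, Real.norm_eq_abs, Real.norm_eq_abs]
    exact mul_le_mul_of_nonneg_left hs (abs_nonneg _)

lemma tendsto_integral_abs_weight_sub {k : ℝ} (hk : 0 < k) {F : ℝ → ℝ}
    (hF : Integrable F unitMeasure) (u : ℝ) :
    Tendsto (fun t ↦ ∫ s, |weight k t s - weight k u s| * F s ∂unitMeasure) (𝓝 u) (𝓝 0) := by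
  have key : ContinuousAt (fun t ↦ ∫ s, |weight k t s - weight k u s| * F s ∂unitMeasure) u := by
    refine continuousAt_of_dominated (bound := fun s ↦ 2 * ‖F s‖) (Eventually.of_forall fun t ↦ ?_)
      (Eventually.of_forall fun t ↦ ?_) (hF.norm.const_mul 2) ?_
    · have hm : Measurable fun s ↦ |weight k t s - weight k u s| :=
        ((measurable_weight k t).sub (measurable_weight k u)).norm
      exact hm.aestronglyMeasurable.mul hF.aestronglyMeasurable
    · filter_upwards [ae_unitMeasure_mem_Ioo] with s hs
      rw [norm_mul, Real.norm_eq_abs, abs_abs]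
      refine mul_le_mul_of_nonneg_right ?_ (norm_nonneg _)
      have h1 := norm_weight_le_one (t := t) hk hs.1.le
      have h2 := norm_weight_le_one (t := u) hk hs.1.le
      have := norm_sub_le (weight k t s) (weight k u s)
      rw [Real.norm_eq_abs (_ - _)] at this
      linarith
    · filter_upwards [ae_unitMeasure_mem_Ioo, ae_unitMeasure_ne u] with s hs hne
      exact ((continuousAt_weight hs.1 hne).sub continuousAt_const).abs.mul continuousAt_const
  simpa [ContinuousAt] using key

/-- On the unit ball positivity gives `|T x| ≤ T 1` almost everywhere. This single integrable
majorant makes the image equicontinuous, and Arzelà–Ascoli applies. -/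
lemma isCompactOperator_greenOp_comp {k : ℝ} (hk : 0 < k) {T : SpaceC →L[ℝ] SpaceL}
    (hT : IsPositiveOperator T) : IsCompactOperator (greenOp k hk ∘L T) := by
  refine (isCompactOperator_iff_isCompact_closure_image_closedBall
    ((greenOp k hk ∘L T : SpaceC →L[ℝ] SpaceC) : SpaceC →ₗ[ℝ] SpaceC) zero_lt_one).2 ?_
  set A : Set SpaceC := (greenOp k hk ∘L T) '' Metric.closedBall 0 1
  let e := ContinuousMap.linearIsometryBoundedOfCompact unitInterval ℝ ℝ
  have hA : IsCompact (closure (e '' A)) := by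
    refine BoundedContinuousFunction.arzela_ascoli
      (Metric.closedBall 0 ‖greenOp k hk ∘L T‖) (isCompact_closedBall _ _) _ ?_ ?_
    · rintro _ t ⟨_, ⟨x, hx, rfl⟩, rfl⟩
      rw [mem_closedBall_zero_iff] at hx ⊢
      refine (ContinuousMap.norm_coe_le_norm ((greenOp k hk ∘L T) x) t).trans ?_
      exact ((greenOp k hk ∘L T).le_opNorm x).trans
        (mul_le_of_le_one_right (norm_nonneg _) hx)
    · intro t₀
      have hlim := (tendsto_integral_abs_weight_sub hk (integrable_coe (T 1)) t₀).comp
        (continuous_subtype_val.tendsto t₀)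
      refine Metric.equicontinuousAt_of_continuity_modulus _ hlim _ (Eventually.of_forall ?_)
      rintro t ⟨_, _, ⟨x, hx, rfl⟩, rfl⟩
      rw [mem_closedBall_zero_iff] at hx
      have hb : ∀ t, |x t| ≤ 1 := fun t ↦ (x.norm_coe_le_norm t).trans hx
      rw [dist_comm]
      refine abs_green_sub_le hk (integrable_coe (T x)) (integrable_coe (T 1)) ?_ t t₀
      filter_upwards [hT.ae_le fun t ↦ (abs_le.1 (hb t)).2, hT.le_ae fun t ↦ (abs_le.1 (hb t)).1]
        with s h1 h2
      rw [one_mul] at h1 h2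
      exact abs_le.2 ⟨h2, h1⟩
  have : e '' closure A = closure (e '' A) :=
    e.toHomeomorph.image_closure A
  rw [← this] at hA
  exact e.toHomeomorph.isCompact_image.1 hA

/-- For a compact `K`, either `1` is an eigenvalue or `1 - K` is bijective. -/
lemma uniquelySolvable_of_ker {k : ℝ} (hk : 0 < k) {Tp Tm : SpaceC →L[ℝ] SpaceL}
    (hTp : IsPositiveOperator Tp) (hTm : IsPositiveOperator Tm)
    (hker : ∀ x, x = greenOp k hk (Tp x - Tm x) → x = 0) : UniquelySolvable k (Tp - Tm) := by
  set K : SpaceC →L[ℝ] SpaceC := greenOp k hk ∘L (Tp - Tm) with hK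
  have hcomp : IsCompactOperator K := by
    rw [hK, ContinuousLinearMap.comp_sub]
    exact (isCompactOperator_greenOp_comp hk hTp).sub (isCompactOperator_greenOp_comp hk hTm)
  have hres : (1 : ℝ) ∈ resolventSet ℝ K := by
    refine (hcomp.hasEigenvalue_or_mem_resolventSet one_ne_zero).resolve_left fun h ↦ ?_
    obtain ⟨x, hx⟩ := h.exists_hasEigenvector
    refine hx.2 (hker x ?_)
    have := hx.apply_eq_smul
    rw [one_smul] at this
    exact this.symm
  rw [spectrum.mem_resolventSet_iff, map_one] at hres
  have hbij : Function.Bijective (1 - K : SpaceC →L[ℝ] SpaceC) :=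
    (ContinuousLinearMap.isUnit_iff_bijective).1 hres
  intro f
  simp only [isCauchySolution_iff hk]
  have hiff : ∀ x, x = greenOp k hk ((Tp - Tm) x + f) ↔
      (1 - K : SpaceC →L[ℝ] SpaceC) x = greenOp k hk f := fun x ↦ by
    rw [map_add, show (1 - K : SpaceC →L[ℝ] SpaceC) x = x - greenOp k hk ((Tp - Tm) x) from rfl,
      sub_eq_iff_eq_add, add_comm]
  simp only [hiff]
  exact hbij.existsUnique _

/-! ### Sufficiency: strict estimates at the extrema -/

/-- A positive value of a solution is strictly below the integral of any majorant of its data. -/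
lemma green_lt_integral {k : ℝ} (hk : 0 < k) {h φ : ℝ → ℝ} (hh : Integrable h unitMeasure)
    (hφ : Integrable φ unitMeasure) (hφ0 : ∀ᵐ s ∂unitMeasure, 0 ≤ φ s)
    (hle : ∀ᵐ s ∂unitMeasure, h s ≤ φ s) {t : ℝ} (ht : t ∈ Ioc (0 : ℝ) 1)
    (hpos : 0 < green k h t) : green k h t < ∫ s in (0 : ℝ)..t, φ s := by
  have h1 : green k h t ≤ green k φ t := by
    refine integral_mono_ae (integrable_weight_mul hk t hh) (integrable_weight_mul hk t hφ) ?_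
    filter_upwards [hle, ae_unitMeasure_mem_Ioo] with s hs h0
    exact mul_le_mul_of_nonneg_left hs (weight_nonneg h0.1.le)
  refine h1.trans_lt ?_
  -- Since the kernel is below 1 for `s < t`, equality would force `φ = 0` almost everywhere on
  -- `(0,t]`. Then `green k φ t = 0`, against the positivity of `green k h t`.
  by_contra! hcon
  rw [← setIntegral_Icc_indicator le_rfl ht.1.le ht.2] at hcon
  have hind : Integrable ((Ioc 0 t).indicator φ) unitMeasure := hφ.indicator measurableSet_Ioc
  have hnn : 0 ≤ᵐ[unitMeasure] fun s ↦ (Ioc 0 t).indicator φ s - weight k t s * φ s := by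
    filter_upwards [hφ0, ae_unitMeasure_mem_Ioo] with s hs h0
    by_cases hst : s ≤ t
    · rw [indicator_of_mem (show s ∈ Ioc 0 t from ⟨h0.1, hst⟩), Pi.zero_apply, sub_nonneg]
      exact mul_le_of_le_one_left hs (weight_le_one hk h0.1.le)
    · rw [indicator_of_notMem fun h' ↦ hst h'.2, weight, if_neg hst]
      simp
  have hint : ∫ s, ((Ioc 0 t).indicator φ s - weight k t s * φ s) ∂unitMeasure = 0 := by
    refine le_antisymm ?_ (integral_nonneg_of_ae hnn)
    rw [integral_sub hind (integrable_weight_mul hk t hφ), sub_nonpos]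
    exact hcon
  rw [integral_eq_zero_iff_of_nonneg_ae hnn (hind.sub (integrable_weight_mul hk t hφ))] at hint
  have hz : green k φ t = 0 := by
    refine integral_eq_zero_of_ae ?_
    filter_upwards [hint, ae_unitMeasure_mem_Ioo, ae_unitMeasure_ne t] with s hs h0 hne
    by_cases hst : s ≤ t
    · rw [indicator_of_mem (show s ∈ Ioc 0 t from ⟨h0.1, hst⟩), Pi.zero_apply] at hs
      have hw : weight k t s < 1 := by
        rw [weight, if_pos hst]
        exact Real.rpow_lt_one (div_nonneg h0.1.le ht.1.le)
          ((div_lt_one ht.1).2 (lt_of_le_of_ne hst hne)) hk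
      have : (1 - weight k t s) * φ s = 0 := by linarith
      rcases mul_eq_zero.1 this with h' | h'
      · linarith
      · simp [h']
    · simp [weight, hst]
  linarith

/-- The drop of a solution from a positive value is strictly below the integral of any majorant
of the negated data. -/
lemma neg_green_lt_integral {k : ℝ} (hk : 0 < k) {h ψ : ℝ → ℝ} (hh : Integrable h unitMeasure)
    (hψ : Integrable ψ unitMeasure) (hψ0 : ∀ᵐ s ∂unitMeasure, 0 ≤ ψ s)
    (hle : ∀ᵐ s ∂unitMeasure, -h s ≤ ψ s) {t u : ℝ} (ht : 0 < t) (htu : t < u) (hu : u ≤ 1)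
    (hpos : 0 < green k h t) : -green k h u < ∫ s in t..u, ψ s := by
  have hu0 : 0 < u := ht.trans htu
  have htm : t ∈ Icc (0 : ℝ) 1 := ⟨ht.le, htu.le.trans hu⟩
  have hum : u ∈ Icc (0 : ℝ) 1 := ⟨hu0.le, hu⟩
  have hi := integrableOn_rpow_mul hk hh
  have h1 := rpow_mul_green k h ⟨ht, htm.2⟩
  have h2 := rpow_mul_green k h ⟨hu0, hu⟩
  have hadd := intervalIntegral.integral_add_adjacent_intervals
    (intervalIntegrable_of_mem (a := 0) hi (by simp) htm) (intervalIntegrable_of_mem hi htm hum)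
  have hup := Real.rpow_pos_of_pos hu0 k
  have hle' : -∫ s in t..u, s ^ k * h s ≤ u ^ k * ∫ s in t..u, ψ s := by
    rw [← intervalIntegral.integral_neg, ← intervalIntegral.integral_const_mul]
    refine intervalIntegral.integral_mono_ae_restrict htu.le
      (intervalIntegrable_of_mem hi htm hum).neg
      ((intervalIntegrable_of_mem hψ htm hum).const_mul _) ?_
    have hs : Icc t u ⊆ Icc 0 1 := Icc_subset_Icc htm.1 hu
    filter_upwards [ae_restrict_of_ae_restrict_of_subset hs hψ0,
      ae_restrict_of_ae_restrict_of_subset hs hle, ae_restrict_mem measurableSet_Icc]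
      with s h3 h4 h5
    have hs0 : 0 ≤ s := ht.le.trans h5.1
    calc -(s ^ k * h s) = s ^ k * (-h s) := by ring
      _ ≤ s ^ k * ψ s := mul_le_mul_of_nonneg_left h4 (Real.rpow_nonneg hs0 _)
      _ ≤ u ^ k * ψ s :=
        mul_le_mul_of_nonneg_right (Real.rpow_le_rpow hs0 h5.2 hk.le) h3
  -- Strictness comes from the initial term `t ^ k * green k h t`, which is discarded in the
  -- estimate.
  have htp := mul_pos (Real.rpow_pos_of_pos ht k) hpos
  refine lt_of_mul_lt_mul_left ?_ hup.le
  linarith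

/-- The product of the two inequalities gives `(1-a₁)(1-a₂) < b₁b₂`. But `(1-a₁)(1-a₂) ≥ 1-p` and
`b₁b₂ ≤ (b₁+b₂)²/4 ≤ m²/4 ≤ 1-p`. -/
lemma no_crossing_amplitudes {p m M N a₁ a₂ b₁ b₂ : ℝ} (hM : 0 < M) (hN : 0 ≤ N) (ha₁ : 0 ≤ a₁)
    (ha₂ : 0 ≤ a₂) (hb₁ : 0 ≤ b₁) (hb₂ : 0 ≤ b₂) (ha : a₁ + a₂ ≤ p) (hb : b₁ + b₂ ≤ m)
    (hp : p ≤ 1) (hm : m ^ 2 ≤ 4 * (1 - p)) (h₁ : M < M * a₁ + N * b₁)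
    (h₂ : N < N * a₂ + M * b₂) : False := by
  have e₁ : (1 - a₁) * M < b₁ * N := by linarith
  have e₂ : (1 - a₂) * N < b₂ * M := by linarith
  have n₁ : 0 ≤ (1 - a₁) * M := mul_nonneg (by linarith) hM.le
  have n₂ : 0 ≤ (1 - a₂) * N := mul_nonneg (by linarith) hN
  have hN' : 0 < N := by
    rcases hN.eq_or_lt with h | h
    · rw [← h, mul_zero] at e₁
      linarith
    · exact h
  have h3 : (1 - a₁) * (1 - a₂) * (M * N) < b₁ * b₂ * (M * N) := by
    have := mul_lt_mul'' e₁ e₂ n₁ n₂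
    linarith
  have h4 := lt_of_mul_lt_mul_right h3 (mul_pos hM hN').le
  nlinarith [sq_nonneg (b₁ - b₂), mul_nonneg ha₁ ha₂]

lemma integral_apply_one_le (T : SpaceC →L[ℝ] SpaceL) :
    ∫ s in (0 : ℝ)..1, T 1 s ≤ ‖T‖ := by
  have h1 : ‖T 1‖ ≤ ‖T‖ := by simpa using T.le_opNorm 1
  rw [L1.norm_eq_integral_norm] at h1
  rw [intervalIntegral.integral_of_le zero_le_one, ← integral_Icc_eq_integral_Ioc]
  exact (integral_mono_ae (integrable_coe _) (integrable_coe _).norm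
    (Eventually.of_forall fun s ↦ le_abs_self _)).trans h1

lemma intervalIntegral_nonneg_of_ae_unit {f : ℝ → ℝ} (hf : ∀ᵐ s ∂unitMeasure, 0 ≤ f s) {a b : ℝ}
    (ha : 0 ≤ a) (hab : a ≤ b) (hb : b ≤ 1) : 0 ≤ ∫ s in a..b, f s :=
  intervalIntegral.integral_nonneg_of_ae_restrict hab
    (ae_restrict_of_ae_restrict_of_subset (Icc_subset_Icc ha hb) hf)

lemma integral_add_integral_le {T : SpaceC →L[ℝ] SpaceL} (hT : IsPositiveOperator T) {t u : ℝ}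
    (ht : 0 ≤ t) (htu : t ≤ u) (hu : u ≤ 1) :
    (∫ s in (0 : ℝ)..t, T 1 s) + ∫ s in t..u, T 1 s ≤ ‖T‖ := by
  have hi := integrableOn_coe (T 1)
  have hum : u ∈ Icc (0 : ℝ) 1 := ⟨ht.trans htu, hu⟩
  have htm : t ∈ Icc (0 : ℝ) 1 := ⟨ht, htu.trans hu⟩
  rw [intervalIntegral.integral_add_adjacent_intervals
    (intervalIntegrable_of_mem hi (by simp) htm) (intervalIntegrable_of_mem hi htm hum)]
  have h1 := intervalIntegral.integral_add_adjacent_intervals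
    (intervalIntegrable_of_mem (a := 0) hi (by simp) hum)
    (intervalIntegrable_of_mem (b := 1) hi hum (by simp))
  have h2 := intervalIntegral_nonneg_of_ae_unit hT.ae_nonneg hum.1 hu le_rfl
  linarith [integral_apply_one_le T]

/-- The alternative `x u = 0` covers nonnegative solutions, for which the order of the extrema is
irrelevant and the estimate at the maximum alone suffices. -/
lemma false_of_max_before_min {k : ℝ} (hk : 0 < k) {Tp Tm : SpaceC →L[ℝ] SpaceL}
    (hTp : IsPositiveOperator Tp) (hTm : IsPositiveOperator Tm) (hp : ‖Tp‖ ≤ 1)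
    (hm : ‖Tm‖ ^ 2 ≤ 4 * (1 - ‖Tp‖)) {x : SpaceC} (hx : x = greenOp k hk (Tp x - Tm x))
    {t u : unitInterval} (hmax : ∀ s, x s ≤ x t) (hmin : ∀ s, x u ≤ x s) (hpos : 0 < x t)
    (hu : x u ≤ 0) (htu : t ≤ u ∨ x u = 0) : False := by
  obtain ⟨N, hN⟩ : ∃ N, N = -x u := ⟨_, rfl⟩
  obtain ⟨M, hM⟩ : ∃ M, M = x t := ⟨_, rfl⟩
  have hN0 : 0 ≤ N := by linarith
  have hmin' : ∀ s, -N ≤ x s := fun s ↦ by rw [hN, neg_neg]; exact hmin s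
  rw [← hM] at hmax hpos
  have iA := integrable_coe (Tp 1)
  have iB := integrable_coe (Tm 1)
  have gx : ∀ s : unitInterval, green k (Tp x - Tm x : SpaceL) s = x s := fun s ↦
    (congrArg (· s) hx).symm
  have ht0 : (0 : ℝ) < t := by
    refine lt_of_le_of_ne t.2.1 fun h ↦ ?_
    have := gx t
    rw [← h, green_zero, ← hM] at this
    exact hpos.ne this
  have hA0 := hTp.ae_nonneg
  have hB0 := hTm.ae_nonneg
  have hup : ∀ᵐ s ∂unitMeasure, (Tp x - Tm x : SpaceL) s ≤ M * Tp 1 s + N * Tm 1 s := by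
    filter_upwards [hTp.ae_le hmax, hTm.le_ae hmin', Lp.coeFn_sub (Tp x) (Tm x)] with s h1 h2 h3
    rw [h3, Pi.sub_apply]
    linarith
  have hlow : ∀ᵐ s ∂unitMeasure, -(Tp x - Tm x : SpaceL) s ≤ N * Tp 1 s + M * Tm 1 s := by
    filter_upwards [hTp.le_ae hmin', hTm.ae_le hmax, Lp.coeFn_sub (Tp x) (Tm x)] with s h1 h2 h3
    rw [h3, Pi.sub_apply]
    linarith
  have hcomb : ∀ {c d : ℝ}, 0 ≤ c → 0 ≤ d →
      ∀ᵐ s ∂unitMeasure, 0 ≤ c * Tp 1 s + d * Tm 1 s := fun hc hd ↦ by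
    filter_upwards [hA0, hB0] with s h1 h2 using by positivity
  have hint : ∀ (c d : ℝ) {a b : ℝ}, a ∈ Icc (0 : ℝ) 1 → b ∈ Icc (0 : ℝ) 1 →
      ∫ s in a..b, (c * Tp 1 s + d * Tm 1 s) =
        c * (∫ s in a..b, Tp 1 s) + d * ∫ s in a..b, Tm 1 s := fun c d a b ha hb ↦ by
    rw [intervalIntegral.integral_add ((intervalIntegrable_of_mem iA ha hb).const_mul c)
      ((intervalIntegrable_of_mem iB ha hb).const_mul d), intervalIntegral.integral_const_mul,
      intervalIntegral.integral_const_mul]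
  have h1 := green_lt_integral hk (integrable_coe _) ((iA.const_mul M).add (iB.const_mul N))
    (hcomb hpos.le hN0) hup ⟨ht0, t.2.2⟩ (by rwa [gx, ← hM])
  simp only [Pi.add_apply] at h1
  rw [gx, ← hM, hint M N (by simp) t.2] at h1
  have ha₁ := intervalIntegral_nonneg_of_ae_unit hA0 le_rfl ht0.le t.2.2
  have hb₁ := intervalIntegral_nonneg_of_ae_unit hB0 le_rfl ht0.le t.2.2
  by_cases hu0 : x u = 0
  · rw [show N = 0 by rw [hN, hu0, neg_zero], zero_mul, add_zero] at h1
    have h2 := integral_add_integral_le hTp ht0.le t.2.2 le_rfl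
    have h3 := intervalIntegral_nonneg_of_ae_unit hA0 ht0.le t.2.2 le_rfl
    exact absurd h1 (not_lt.2 (mul_le_of_le_one_right hpos.le (by linarith)))
  have htu' : (t : ℝ) < u := by
    refine lt_of_le_of_ne (htu.resolve_right hu0) fun h ↦ ?_
    rw [Subtype.ext h] at hM
    linarith
  have h2 := neg_green_lt_integral hk (integrable_coe _) ((iA.const_mul N).add (iB.const_mul M))
    (hcomb hN0 hpos.le) hlow ht0 htu' u.2.2 (by rwa [gx, ← hM])
  simp only [Pi.add_apply] at h2
  rw [gx, ← hN, hint N M t.2 u.2] at h2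
  exact no_crossing_amplitudes hpos hN0 ha₁
    (intervalIntegral_nonneg_of_ae_unit hA0 ht0.le htu'.le u.2.2) hb₁
    (intervalIntegral_nonneg_of_ae_unit hB0 ht0.le htu'.le u.2.2)
    (integral_add_integral_le hTp ht0.le htu'.le u.2.2)
    (integral_add_integral_le hTm ht0.le htu'.le u.2.2) hp hm h1 h2

lemma eq_zero_of_eq_greenOp {k : ℝ} (hk : 0 < k) {Tp Tm : SpaceC →L[ℝ] SpaceL}
    (hTp : IsPositiveOperator Tp) (hTm : IsPositiveOperator Tm) (hp : ‖Tp‖ ≤ 1)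
    (hm : ‖Tm‖ ^ 2 ≤ 4 * (1 - ‖Tp‖)) {x : SpaceC} (hx : x = greenOp k hk (Tp x - Tm x)) :
    x = 0 := by
  obtain ⟨t, -, ht⟩ := isCompact_univ.exists_isMaxOn univ_nonempty x.continuous.continuousOn
  obtain ⟨u, -, hu⟩ := isCompact_univ.exists_isMinOn univ_nonempty x.continuous.continuousOn
  have hmax : ∀ s, x s ≤ x t := fun s ↦ ht (mem_univ s)
  have hmin : ∀ s, x u ≤ x s := fun s ↦ hu (mem_univ s)
  have h0 : x 0 = 0 := by
    rw [hx, greenOp_apply]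
    exact green_zero _ _
  have ht0 : 0 ≤ x t := h0 ▸ hmax 0
  have hu0 : x u ≤ 0 := h0 ▸ hmin 0
  -- The equation is linear, so passing to `-x` exchanges maximum and minimum and settles the
  -- opposite order.
  have hx' : -x = greenOp k hk (Tp (-x) - Tm (-x)) := by
    rw [map_neg, map_neg, ← neg_sub', map_neg, ← hx]
  have main := false_of_max_before_min hk hTp hTm hp hm hx hmax hmin
  have main' := false_of_max_before_min hk hTp hTm hp hm hx' (t := u) (u := t)
    (fun s ↦ neg_le_neg (hmin s)) (fun s ↦ neg_le_neg (hmax s))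
  simp only [ContinuousMap.neg_apply, neg_pos, Left.neg_nonpos_iff, neg_eq_zero] at main'
  rcases ht0.eq_or_lt with h | h
  · rcases hu0.eq_or_lt with h' | h'
    · ext s
      exact le_antisymm ((hmax s).trans h.ge) (h'.ge.trans (hmin s))
    · exact (main' h' ht0 (Or.inr h.symm)).elim
  · rcases hu0.eq_or_lt with h' | h'
    · exact (main h hu0 (Or.inr h')).elim
    · rcases le_total t u with htu | htu
      · exact (main h hu0 (Or.inl htu)).elim
      · exact (main' h' ht0 (Or.inl htu)).elim

/-! ### Necessity: operators with a nontrivial homogeneous solution -/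

lemma IsPositiveOperator.norm_eq {T : SpaceC →L[ℝ] SpaceL} (hT : IsPositiveOperator T) :
    ‖T‖ = ‖T 1‖ := by
  refine le_antisymm (T.opNorm_le_bound (norm_nonneg _) fun x ↦ ?_) (by simpa using T.le_opNorm 1)
  rw [mul_comm]
  refine Lp.norm_le_mul_norm_of_ae_le_mul ?_
  have hb : ∀ t, |x t| ≤ ‖x‖ := fun t ↦ x.norm_coe_le_norm t
  filter_upwards [hT.ae_le fun t ↦ (abs_le.1 (hb t)).2, hT.le_ae fun t ↦ (abs_le.1 (hb t)).1,
    hT.ae_nonneg] with s h1 h2 h3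
  rw [Real.norm_of_nonneg h3]
  exact abs_le.2 ⟨h2, h1⟩

lemma norm_add_of_nonneg {f g : SpaceL} (hf : 0 ≤ f) (hg : 0 ≤ g) : ‖f + g‖ = ‖f‖ + ‖g‖ := by
  simp only [L1.norm_eq_integral_norm]
  rw [← integral_add (integrable_coe f).norm (integrable_coe g).norm]
  refine integral_congr_ae ?_
  filter_upwards [Lp.coeFn_add f g, (Lp.coeFn_nonneg f).2 hf, (Lp.coeFn_nonneg g).2 hg]
    with s h1 h2 h3
  rw [Pi.zero_apply] at h2 h3
  rw [h1, Pi.add_apply, Real.norm_of_nonneg h2, Real.norm_of_nonneg h3,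
    Real.norm_of_nonneg (add_nonneg h2 h3)]

/-- The operator `x ↦ x(t) e`. -/
def pointOp (t : unitInterval) (e : SpaceL) : SpaceC →L[ℝ] SpaceL :=
  (ContinuousMap.evalCLM ℝ t).smulRight e

lemma pointOp_apply (t : unitInterval) (e : SpaceL) (x : SpaceC) : pointOp t e x = x t • e := rfl

lemma smul_nonneg_spaceL {c : ℝ} {e : SpaceL} (hc : 0 ≤ c) (he : 0 ≤ e) : 0 ≤ c • e := by
  rw [← Lp.coeFn_nonneg] at he ⊢
  filter_upwards [he, Lp.coeFn_smul c e] with s h1 h2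
  rw [h2]
  exact mul_nonneg hc h1

lemma isPositiveOperator_pointOp (t : unitInterval) {e : SpaceL} (he : 0 ≤ e) :
    IsPositiveOperator (pointOp t e) := fun _ hx ↦ smul_nonneg_spaceL (hx t) he

lemma IsPositiveOperator.add {T S : SpaceC →L[ℝ] SpaceL} (hT : IsPositiveOperator T)
    (hS : IsPositiveOperator S) : IsPositiveOperator (T + S) := fun x hx ↦
  add_nonneg (hT x hx) (hS x hx)

lemma exists_spaceL_norm_eq_one : ∃ e : SpaceL, 0 ≤ e ∧ ‖e‖ = 1 := by
  have hi : Integrable (fun _ : ℝ ↦ (1 : ℝ)) unitMeasure := integrable_const 1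
  refine ⟨hi.toL1 _, ?_, ?_⟩
  · rw [← Lp.coeFn_nonneg]
    filter_upwards [hi.coeFn_toL1] with s hs
    rw [hs]
    exact zero_le_one
  · rw [L1.norm_of_fun_eq_integral_norm]
    simp

/-- A positive operator can be enlarged to one of prescribed larger norm without changing its
values on functions vanishing at `0`. -/
lemma IsPositiveOperator.exists_norm_eq {T : SpaceC →L[ℝ] SpaceL} (hT : IsPositiveOperator T)
    {τ : ℝ} (h : ‖T‖ ≤ τ) :
    ∃ S : SpaceC →L[ℝ] SpaceL, IsPositiveOperator S ∧ ‖S‖ = τ ∧ ∀ x, x 0 = 0 → S x = T x := by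
  obtain ⟨e, he, he1⟩ := exists_spaceL_norm_eq_one
  have hc : 0 ≤ τ - ‖T‖ := sub_nonneg.2 h
  have hce := smul_nonneg_spaceL hc he
  -- The missing norm is supplied by a multiple of `x ↦ x(0) e`, and norms of nonnegative elements
  -- of `L` add.
  have hS := hT.add (isPositiveOperator_pointOp 0 hce)
  refine ⟨_, hS, ?_, fun x hx ↦ ?_⟩
  · have h1 : (T + pointOp 0 ((τ - ‖T‖) • e)) 1 = T 1 + (τ - ‖T‖) • e := by
      rw [add_apply, pointOp_apply, ContinuousMap.one_apply, one_smul]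
    rw [hS.norm_eq, h1, norm_add_of_nonneg (hT 1 fun _ ↦ zero_le_one) hce, norm_smul, he1,
      ← hT.norm_eq, Real.norm_of_nonneg hc]
    ring
  · rw [add_apply, pointOp_apply, hx, zero_smul, add_zero]

/-- A forcing term supported in `(α, β]` whose response at `β` equals `1`. -/
def bump (k α β : ℝ) : ℝ → ℝ := (Ioc α β).indicator fun s ↦ (β / s) ^ k / (β - α)

lemma bump_nonneg {k α β : ℝ} (hα : 0 < α) (h : α < β) (s : ℝ) : 0 ≤ bump k α β s := by
  refine indicator_nonneg (fun s hs ↦ ?_) s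
  exact div_nonneg (Real.rpow_nonneg (div_nonneg (hα.trans h).le (hα.trans hs.1).le) _)
    (sub_nonneg.2 h.le)

lemma bump_le {k α β : ℝ} (hk : 0 < k) (hα : 0 < α) (h : α < β) (s : ℝ) :
    bump k α β s ≤ (Ioc α β).indicator (fun _ ↦ (β / α) ^ k / (β - α)) s := by
  refine indicator_le_indicator' fun hs ↦ ?_
  have hβ := hα.trans h
  have hs0 := hα.trans hs.1
  have := sub_pos.2 h
  gcongr
  exact hs.1.le

lemma integrable_bump {k α β : ℝ} (hk : 0 < k) (hα : 0 < α) (h : α < β) :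
    Integrable (bump k α β) unitMeasure := by
  refine Integrable.mono' ((integrable_const ((β / α) ^ k / (β - α))).indicator
    (measurableSet_Ioc (a := α) (b := β))) ?_
    (Eventually.of_forall fun s ↦ ?_)
  · exact (Measurable.indicator (by fun_prop) measurableSet_Ioc).aestronglyMeasurable
  · rw [Real.norm_of_nonneg (bump_nonneg hα h s)]
    exact bump_le hk hα h s

lemma integral_bump_le {k α β : ℝ} (hk : 0 < k) (hα : 0 < α) (h : α < β) (hβ : β ≤ 1) :
    ∫ s, bump k α β s ∂unitMeasure ≤ (β / α) ^ k := by
  refine (integral_mono (integrable_bump hk hα h) ((integrable_const _).indicator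
    measurableSet_Ioc) (bump_le hk hα h)).trans_eq ?_
  rw [setIntegral_Icc_indicator hα.le h.le hβ, intervalIntegral.integral_const, smul_eq_mul]
  field_simp [(sub_pos.2 h).ne']

lemma green_bump_of_le (k : ℝ) {α β t : ℝ} (h : t ≤ α) : green k (bump k α β) t = 0 := by
  refine integral_eq_zero_of_ae (Eventually.of_forall fun s ↦ ?_)
  by_cases hs : s ≤ t
  · simp [bump, hs.trans h]
  · simp [weight, hs]

lemma green_bump_of_ge {k α β t : ℝ} (hα : 0 < α) (h : α < β) (ht : β ≤ t) (ht1 : t ≤ 1) :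
    green k (bump k α β) t = (β / t) ^ k := by
  have hβ := hα.trans h
  have ht0 := hβ.trans_le ht
  have : ∀ s, weight k t s * bump k α β s =
      (Ioc α β).indicator (fun _ ↦ (β / t) ^ k / (β - α)) s := fun s ↦ by
    by_cases hs : s ∈ Ioc α β
    · have hs0 := hα.trans hs.1
      rw [bump, indicator_of_mem hs, indicator_of_mem hs, weight, if_pos (hs.2.trans ht),
        ← mul_div_assoc, ← Real.mul_rpow (by positivity) (by positivity)]
      congr 2
      field_simp
    · rw [bump, indicator_of_notMem hs, indicator_of_notMem hs, mul_zero]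
  rw [green]
  simp only [this]
  rw [setIntegral_Icc_indicator hα.le h.le (ht.trans ht1), intervalIntegral.integral_const,
    smul_eq_mul]
  field_simp [(sub_pos.2 h).ne']

/-- The forcing lives on `(ρβ, β]`. Its norm is at most `ρ ^ (-k)`, so a unit response at `β` costs
little more than 1 when `ρ` is near 1. -/
lemma exists_spaceL_bump {k ρ β : ℝ} (hk : 0 < k) (hρ : 0 < ρ) (hρ1 : ρ < 1) (hβ : 0 < β)
    (hβ1 : β ≤ 1) : ∃ e : SpaceL, 0 ≤ e ∧ ‖e‖ * ρ ^ k ≤ 1 ∧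
      (∀ t ≤ ρ * β, green k e t = 0) ∧ ∀ t, β ≤ t → t ≤ 1 → green k e t = (β / t) ^ k := by
  have hα : 0 < ρ * β := mul_pos hρ hβ
  have h : ρ * β < β := mul_lt_of_lt_one_left hβ hρ1
  have hi := integrable_bump hk hα h
  refine ⟨hi.toL1 _, ?_, ?_, fun t ht ↦ ?_, fun t ht ht1 ↦ ?_⟩
  · rw [← Lp.coeFn_nonneg]
    filter_upwards [hi.coeFn_toL1] with s hs
    rw [hs]
    exact bump_nonneg hα h s
  · rw [L1.norm_of_fun_eq_integral_norm]
    simp only [Real.norm_of_nonneg (bump_nonneg hα h _)]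
    have h1 := integral_bump_le hk hα h hβ1
    rw [show β / (ρ * β) = ρ⁻¹ by field_simp, Real.inv_rpow hρ.le] at h1
    have hr := Real.rpow_pos_of_pos hρ k
    calc _ ≤ (ρ ^ k)⁻¹ * ρ ^ k := mul_le_mul_of_nonneg_right h1 hr.le
      _ = 1 := inv_mul_cancel₀ hr.ne'
  · rw [green_congr hi.coeFn_toL1, green_bump_of_le k ht]
  · rw [green_congr hi.coeFn_toL1, green_bump_of_ge hα h ht ht1]

/-- Operators realizing a nontrivial solution of the homogeneous problem. -/
lemma exists_not_uniquelySolvable {k p m A b₁ b₂ q r : ℝ} (hk : 0 < k) (hr : 0 < r) (hr1 : r < 1)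
    (hq : 0 < q) (hqr : q ≤ r) (hA : 0 ≤ A) (hb₁ : 0 ≤ b₁) (hb₂ : 0 ≤ b₂) (hp : A ≤ p * r)
    (hm : b₁ + b₂ ≤ m * r) (heq : 1 - A + q * b₁ = b₁ * b₂) :
    ∃ Tp Tm : SpaceC →L[ℝ] SpaceL, IsPositiveOperator Tp ∧ IsPositiveOperator Tm ∧ ‖Tp‖ = p ∧
      ‖Tm‖ = m ∧ ¬ UniquelySolvable k (Tp - Tm) := by
  -- `r = ρ ^ k` is the norm loss of the bumps, and `q = τ ^ k` is what free decay leaves at time 1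
  -- of the value 1 at time `τ`.
  obtain ⟨ρ, hρ⟩ : ∃ ρ, ρ = r ^ k⁻¹ := ⟨_, rfl⟩
  obtain ⟨τ, hτ⟩ : ∃ τ, τ = q ^ k⁻¹ := ⟨_, rfl⟩
  have hki := inv_pos.2 hk
  have hρ0 : 0 < ρ := hρ ▸ Real.rpow_pos_of_pos hr _
  have hτ0 : 0 < τ := hτ ▸ Real.rpow_pos_of_pos hq _
  have hρ1 : ρ < 1 := hρ ▸ Real.rpow_lt_one hr.le hr1 hki
  have hτρ : τ ≤ ρ := by rw [hρ, hτ]; exact Real.rpow_le_rpow hq.le hqr hki.le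
  have hτ1 : τ ≤ 1 := hτρ.trans hρ1.le
  have hρk : ρ ^ k = r := by rw [hρ, Real.rpow_inv_rpow hr.le hk.ne']
  have hτk : τ ^ k = q := by rw [hτ, Real.rpow_inv_rpow hq.le hk.ne']
  obtain ⟨e₁, h₁, n₁, -, g₁⟩ := exists_spaceL_bump hk hρ0 hρ1 hτ0 hτ1
  obtain ⟨e₂, h₂, n₂, z₂, g₂⟩ := exists_spaceL_bump hk hρ0 hρ1 zero_lt_one le_rfl
  rw [hρk] at n₁ n₂
  let t : unitInterval := ⟨τ, hτ0.le, hτ1⟩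
  -- Up to norm padding, `T⁺x = A x(τ) e₁` and `T⁻x = b₁ x(1) e₁ + b₂ x(τ) e₂`, with `e₁` acting
  -- just before `τ` and `e₂` just before `1`.
  have P₀ := isPositiveOperator_pointOp t (smul_nonneg_spaceL hA h₁)
  have P₁ := isPositiveOperator_pointOp 1 (smul_nonneg_spaceL hb₁ h₁)
  have P₂ := isPositiveOperator_pointOp t (smul_nonneg_spaceL hb₂ h₂)
  have hle : ∀ {e : SpaceL}, ‖e‖ * r ≤ 1 → ∀ {c : ℝ}, 0 ≤ c → ‖c • e‖ * r ≤ c := fun he c hc ↦ by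
    rw [norm_smul, Real.norm_of_nonneg hc, mul_assoc]
    exact mul_le_of_le_one_right hc he
  have hTp : ‖pointOp t (A • e₁)‖ ≤ p := by
    rw [P₀.norm_eq, pointOp_apply, ContinuousMap.one_apply, one_smul]
    exact le_of_mul_le_mul_right ((hle n₁ hA).trans hp) hr
  have hTm : ‖pointOp 1 (b₁ • e₁) + pointOp t (b₂ • e₂)‖ ≤ m := by
    rw [(P₁.add P₂).norm_eq, add_apply, pointOp_apply, pointOp_apply, ContinuousMap.one_apply,
      ContinuousMap.one_apply, one_smul, one_smul]
    refine le_of_mul_le_mul_right (le_trans ?_ hm) hr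
    refine (mul_le_mul_of_nonneg_right (norm_add_le _ _) hr.le).trans ?_
    rw [add_mul]
    exact add_le_add (hle n₁ hb₁) (hle n₂ hb₂)
  obtain ⟨Tp, pTp, nTp, eTp⟩ := P₀.exists_norm_eq hTp
  obtain ⟨Tm, pTm, nTm, eTm⟩ := (P₁.add P₂).exists_norm_eq hTm
  refine ⟨Tp, Tm, pTp, pTm, nTp, nTm, fun hU ↦ ?_⟩
  set w : SpaceC := greenOp k hk (e₁ - b₂ • e₂) with hw
  have hwv : ∀ s : unitInterval, w s = green k e₁ s - b₂ * green k e₂ s := fun s ↦ by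
    rw [hw, map_sub, map_smul, ContinuousMap.sub_apply, ContinuousMap.smul_apply, greenOp_apply,
      greenOp_apply, smul_eq_mul]
  have hw0 : w 0 = 0 := green_zero _ _
  have hwt : w t = 1 := by
    -- The second bump starts at `ρ ≥ τ`, so it does not affect the value at `τ`; this is where `q ≤
    -- r` is needed.
    rw [hwv, g₁ τ le_rfl hτ1, z₂ τ (by rwa [mul_one]), div_self hτ0.ne', Real.one_rpow]
    ring
  have hw1 : w 1 = q - b₂ := by
    rw [hwv, Set.Icc.coe_one, g₁ 1 hτ1 le_rfl, g₂ 1 le_rfl le_rfl, div_one, div_one, hτk,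
      Real.one_rpow, mul_one]
  have hTw : (Tp - Tm) w = e₁ - b₂ • e₂ := by
    rw [sub_apply, eTp w hw0, eTm w hw0, add_apply]
    simp only [pointOp_apply, hwt, hw1, smul_smul, one_mul]
    -- The coefficient of `e₁` is `A - b₁ w(1)`, and `heq` says precisely that it equals 1.
    rw [← sub_sub, ← sub_smul, show A - (q - b₂) * b₁ = 1 by linarith, one_smul]
  have s0 : IsCauchySolution k (Tp - Tm) 0 0 := by simp [isCauchySolution_iff hk]
  have s1 : IsCauchySolution k (Tp - Tm) 0 w := by
    rw [isCauchySolution_iff hk, add_zero, hTw]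
  have := (hU 0).unique s0 s1
  rw [← this] at hwt
  exact zero_ne_one hwt

/-- For `p ≤ 1` the failure of the condition means `m²/4 + p > 1`. By continuity this survives
replacing `m, p` by `m r, p r` with `r < 1` close to 1. -/
lemma exists_parameters {p m : ℝ} (hp0 : 0 ≤ p) (hm0 : 0 ≤ m)
    (h : ¬ (p ≤ 1 ∧ m ≤ 2 * Real.sqrt (1 - p))) :
    ∃ A b₁ b₂ q r : ℝ, 0 < r ∧ r < 1 ∧ 0 < q ∧ q ≤ r ∧ 0 ≤ A ∧ 0 ≤ b₁ ∧ 0 ≤ b₂ ∧ A ≤ p * r ∧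
      b₁ + b₂ ≤ m * r ∧ 1 - A + q * b₁ = b₁ * b₂ := by
  rcases lt_or_ge 1 p with hp | hp
  · have hp' : 0 < p := zero_lt_one.trans hp
    -- For `p > 1` the positive part suffices: `A = 1` is affordable because `p * p⁻¹ = 1`.
    refine ⟨1, 0, 0, p⁻¹, p⁻¹, inv_pos.2 hp', inv_lt_one_of_one_lt₀ hp, inv_pos.2 hp', le_rfl,
      zero_le_one, le_rfl, le_rfl, (mul_inv_cancel₀ hp'.ne').ge, ?_, by ring⟩
    rw [add_zero]
    exact mul_nonneg hm0 (inv_pos.2 hp').le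
  have hm : 2 * Real.sqrt (1 - p) < m := by
    by_contra! hcon
    exact h ⟨hp, hcon⟩
  have hs := Real.sqrt_nonneg (1 - p)
  have hm1 : 0 < m := by linarith
  have hsq := Real.sq_sqrt (sub_nonneg.2 hp)
  have hF : 0 < (m * 1 / 2) ^ 2 + p * 1 - 1 := by nlinarith
  have hcont : ContinuousAt (fun r : ℝ ↦ (m * r / 2) ^ 2 + p * r - 1) 1 := by fun_prop
  have hev : ∀ᶠ r in 𝓝[<] (1 : ℝ), 0 < (m * r / 2) ^ 2 + p * r - 1 :=
    (hcont.eventually (lt_mem_nhds hF)).filter_mono nhdsWithin_le_nhds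
  obtain ⟨r, hr, hr0, hr1⟩ := (hev.and (Ioo_mem_nhdsLT zero_lt_one)).exists
  have hb : 0 < m * r / 2 := by positivity
  obtain ⟨b, hbdef⟩ : ∃ b, b = m * r / 2 := ⟨_, rfl⟩
  rw [← hbdef] at hr hb
  have hpr : p * r ≤ 1 := mul_le_one₀ hp hr0.le hr1.le
  -- With `b₁ = b = m r / 2` and `A = p r`, the equation forces `b₂ = q + (1 - p r)/b`. The second
  -- entry of the minimum is the largest `q` for which `b₂ ≤ b`, that is `b₁ + b₂ ≤ m r`.
  obtain ⟨q, hq⟩ : ∃ q, q = min r ((b ^ 2 + p * r - 1) / b) := ⟨_, rfl⟩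
  have hq0 : 0 < q := hq ▸ lt_min hr0 (div_pos hr hb)
  have hq1 : q ≤ (b ^ 2 + p * r - 1) / b := hq ▸ min_le_right _ _
  refine ⟨p * r, b, q + (1 - p * r) / b, q, r, hr0, hr1, hq0, hq ▸ min_le_left _ _,
    mul_nonneg hp0 hr0.le, hb.le, add_nonneg hq0.le (div_nonneg (sub_nonneg.2 hpr) hb.le),
    le_rfl, ?_, ?_⟩
  · have : (b ^ 2 + p * r - 1) / b + (1 - p * r) / b = b := by
      field_simp
      ring
    linarith
  · field_simp
    ring

end SingularCauchy

end

theorem mainTheorem1 (k τp τm : ℝ) (hk : 0 < k) (hp : 0 ≤ τp) (hm : 0 ≤ τm) :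
    (∀ Tp Tm : SingularCauchy.SpaceC →L[ℝ] SingularCauchy.SpaceL,
      SingularCauchy.IsPositiveOperator Tp → SingularCauchy.IsPositiveOperator Tm →
      ‖Tp‖ = τp → ‖Tm‖ = τm → SingularCauchy.UniquelySolvable k (Tp - Tm)) ↔
    (τp ≤ 1 ∧ τm ≤ 2 * Real.sqrt (1 - τp)) := by
  constructor
  · intro h
    by_contra hcon
    obtain ⟨A, b₁, b₂, q, r, hr, hr1, hq, hqr, hA, hb₁, hb₂, h₁, h₂, heq⟩ :=
      SingularCauchy.exists_parameters hp hm hcon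
    obtain ⟨Tp, Tm, pTp, pTm, nTp, nTm, hU⟩ := SingularCauchy.exists_not_uniquelySolvable
      hk hr hr1 hq hqr hA hb₁ hb₂ h₁ h₂ heq
    exact hU (h Tp Tm pTp pTm nTp nTm)
  · rintro ⟨h1, h2⟩ Tp Tm pTp pTm rfl rfl
    refine SingularCauchy.uniquelySolvable_of_ker hk pTp pTm fun x hx ↦
      SingularCauchy.eq_zero_of_eq_greenOp hk pTp pTm h1 ?_ hx
    calc ‖Tm‖ ^ 2 ≤ (2 * Real.sqrt (1 - ‖Tp‖)) ^ 2 := pow_le_pow_left₀ hm h2 2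
      _ = 4 * (1 - ‖Tp‖) := by rw [mul_pow, Real.sq_sqrt (sub_nonneg.2 h1)]; norm_num
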